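/- Let $\mathbb O$ be the octonions, with conjugation $x\mapsto\bar x$, squared norm $|x|^2=x\bar x$, associator $[x,y,z]=(xy)z-x(yz)$ and the real-valued form $\Phi(x,y,z)=\tfrac12\operatorname{Re}\bigl(x(\bar y z)-z(\bar y x)\bigr)$. Let $$A=\begin{pmatrix}p&a&\bar b\\ \bar a&m&c\\ b&\bar c&n\end{pmatrix}\qquad(p,m,n\in\mathbb R,\ a,b,c\in\mathbb O)$$ be a $3\times3$ octonionic Hermitian matrix. Put $X\circ Y=\tfrac12(XY+YX)$, $\sigma(A)=\tfrac12\bigl((\operatorname{tr}A)^2-\operatorname{tr}(A\circ A)\bigr)$ and $\det A=\tfrac13\operatorname{tr}\bigl((A*A)\circ A\bigr)$, where $X*Y=X\circ Y-\tfrac12(X\operatorname{tr}Y+Y\operatorname{tr}X)+\tfrac12\bigl(\operatorname{tr}X\operatorname{tr}Y-\operatorname{tr}(X\circ Y)\bigr)I$ is the Freudenthal product. Suppose that the quadratic equation $r^2+4\,\Phi(a,b,c)\,r-|[a,b,c]|^2=0$ has two distinct (real) roots, that is, that $\Phi(a,b,c)$ and $[a,b,c]$ are not both zero. For a root $r$ of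 it, the family of eigenvalues of $A$ that belongs to $r$ consists of the real solutions $\lambda$ of the modified characteristic equation $$\lambda^3-(\operatorname{tr}A)\lambda^2+\sigma(A)\lambda-\det A=r .$$ Let $\lambda\ne\mu$ be real numbers in the same family (the same root $r$), and let $v,w\in\mathbb O^3$ be nonzero with $Av=\lambda v$ and $Aw=\mu w$. Then $v$ and $w$ are mutually orthogonal in the generalized sense: $(vv^\dagger)w=0$ and $(ww^\dagger)v=0$. -/

import Mathlib

/-- The octonions `𝕆 = ℍ + ℍ ℓ`, as pairs of real quaternions: `⟨p, q⟩` stands for `p + q ℓ`. -/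
@[ext]
structure Octonion where
  /-- the quaternion `p` of `p + q ℓ` -/
  fst : Quaternion ℝ
  /-- the quaternion `q` of `p + q ℓ` -/
  snd : Quaternion ℝ

namespace Octonion

noncomputable section

instance : Zero Octonion := ⟨⟨0, 0⟩⟩
instance : One Octonion := ⟨⟨1, 0⟩⟩
instance : Add Octonion := ⟨fun x y => ⟨x.fst + y.fst, x.snd + y.snd⟩⟩
instance : Neg Octonion := ⟨fun x => ⟨-x.fst, -x.snd⟩⟩
instance : SMul ℝ Octonion := ⟨fun t x => ⟨t • x.fst, t • x.snd⟩⟩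

/-- The Cayley-Dickson product `(p + q ℓ) (s + t ℓ) = (p s - t̄ q) + (t p + q s̄) ℓ`. -/
instance : Mul Octonion :=
  ⟨fun x y => ⟨x.fst * y.fst - star y.snd * x.snd, y.snd * x.fst + x.snd * star y.fst⟩⟩

/-- The octonionic conjugate of `p + q ℓ` is `p̄ - q ℓ`. -/
instance : Star Octonion := ⟨fun x => ⟨star x.fst, -x.snd⟩⟩

@[simp] theorem zero_fst : (0 : Octonion).fst = 0 := rfl
@[simp] theorem zero_snd : (0 : Octonion).snd = 0 := rfl
@[simp] theorem one_fst : (1 : Octonion).fst = 1 := rfl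
@[simp] theorem one_snd : (1 : Octonion).snd = 0 := rfl
@[simp] theorem add_fst (x y : Octonion) : (x + y).fst = x.fst + y.fst := rfl
@[simp] theorem add_snd (x y : Octonion) : (x + y).snd = x.snd + y.snd := rfl
@[simp] theorem neg_fst (x : Octonion) : (-x).fst = -x.fst := rfl
@[simp] theorem neg_snd (x : Octonion) : (-x).snd = -x.snd := rfl
@[simp] theorem smul_fst (t : ℝ) (x : Octonion) : (t • x).fst = t • x.fst := rfl
@[simp] theorem smul_snd (t : ℝ) (x : Octonion) : (t • x).snd = t • x.snd := rfl
@[simp] theorem mul_fst (x y : Octonion) :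
    (x * y).fst = x.fst * y.fst - star y.snd * x.snd := rfl
@[simp] theorem mul_snd (x y : Octonion) :
    (x * y).snd = y.snd * x.fst + x.snd * star y.fst := rfl
@[simp] theorem star_fst (x : Octonion) : (star x).fst = star x.fst := rfl
@[simp] theorem star_snd (x : Octonion) : (star x).snd = -x.snd := rfl

/-- The octonions form a unital, not necessarily associative ring. -/
instance : NonAssocRing Octonion where
  add_assoc x y z := by ext1 <;> simp only [add_fst, add_snd, add_assoc]
  zero_add x := by ext1 <;> simp only [add_fst, add_snd, zero_fst, zero_snd, zero_add]
  add_zero x := by ext1 <;> simp only [add_fst, add_snd, zero_fst, zero_snd, add_zero]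
  add_comm x y := by ext1 <;> simp only [add_fst, add_snd, add_comm]
  neg_add_cancel x := by
    ext1 <;> simp only [add_fst, add_snd, neg_fst, neg_snd, zero_fst, zero_snd, neg_add_cancel]
  nsmul := nsmulRec
  zsmul := zsmulRec
  left_distrib x y z := by
    ext1 <;> simp only [add_fst, add_snd, mul_fst, mul_snd, star_add, mul_add, add_mul] <;> abel
  right_distrib x y z := by
    ext1 <;> simp only [add_fst, add_snd, mul_fst, mul_snd, mul_add, add_mul] <;> abel
  zero_mul x := by ext1 <;> simp
  mul_zero x := by ext1 <;> simp
  one_mul x := by ext1 <;> simp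
  mul_one x := by ext1 <;> simp

/-- The octonions are a real vector space. -/
instance : Module ℝ Octonion where
  one_smul x := by ext1 <;> simp
  mul_smul s t x := by ext1 <;> simp [mul_smul]
  smul_zero t := by ext1 <;> simp
  smul_add t x y := by ext1 <;> simp
  add_smul s t x := by ext1 <;> simp [add_smul]
  zero_smul x := by ext1 <;> simp

/-- The real part of an octonion. -/
def re (x : Octonion) : ℝ := x.fst.re

/-- The squared norm `|x|² = x x̄` (a real number). -/
def normSq (x : Octonion) : ℝ := re (x * star x)

/-- The associator `[x, y, z] = (x y) z - x (y z)`. -/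
def assoc (x y z : Octonion) : Octonion := x * y * z - x * (y * z)

/-- The associative 3-form `Φ(x, y, z) = ½ Re (x (ȳ z) - z (ȳ x))`. -/
def Phi (x y z : Octonion) : ℝ := 1 / 2 * re (x * (star y * z) - z * (star y * x))

/-- `3 × 3` octonionic matrices. -/
abbrev Mat3 : Type := Matrix (Fin 3) (Fin 3) Octonion

/-- The trace of a Hermitian octonionic matrix, as a real number (the diagonal entries of a
Hermitian matrix are real). -/
def tr (A : Mat3) : ℝ := re A.trace

/-- The Jordan product `A ∘ B = ½ (A B + B A)`. -/
def jordan (A B : Mat3) : Mat3 := (1 / 2 : ℝ) • (A * B + B * A)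

/-- The Freudenthal product
`A * B = A ∘ B - ½ (A tr B + B tr A) + ½ (tr A tr B - tr (A ∘ B)) I`. -/
def freudenthal (A B : Mat3) : Mat3 :=
  jordan A B - (1 / 2 : ℝ) • (tr B • A + tr A • B)
    + (1 / 2 * (tr A * tr B - tr (jordan A B)) : ℝ) • (1 : Mat3)

/-- `σ(A) = ½ ((tr A)² - tr (A²))`, with `A² = A ∘ A`. -/
def sigma (A : Mat3) : ℝ := 1 / 2 * (tr A ^ 2 - tr (jordan A A))

/-- The determinant `det A = ⅓ tr ((A * A) ∘ A)` of a Hermitian octonionic matrix, where `*` is the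
Freudenthal product. -/
def det (A : Mat3) : ℝ := 1 / 3 * tr (jordan (freudenthal A A) A)

/-- The characteristic polynomial `det (t I - A) = t³ - (tr A) t² + σ(A) t - det A`, as a
function of the real number `t`. -/
def charFun (A : Mat3) (t : ℝ) : ℝ := t ^ 3 - tr A * t ^ 2 + sigma A * t - det A

/-- The real roots `r` of `r² + 4 Φ(a, b, c) r - |[a, b, c]|² = 0`, where `a`, `b`, `c` are the
off-diagonal entries of `A = !![p, a, b̄; ā, m, c; b, c̄, n]`. -/
def familyRoots (A : Mat3) : Set ℝ :=
  {r | r ^ 2 + 4 * Phi (A 0 1) (A 2 0) (A 1 2) * r - normSq (assoc (A 0 1) (A 2 0) (A 1 2)) = 0}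

/-- The family of eigenvalues of `A` that belongs to the root `r`: the real solutions `t` of the
modified characteristic equation `det (t I - A) = r`. -/
def family (A : Mat3) (r : ℝ) : Set ℝ := {t | charFun A t = r}

/-- `v` is an eigenvector of `A` with the real eigenvalue `t`: `A v = t v` and `v ≠ 0`. -/
def IsEigenvector (A : Mat3) (t : ℝ) (v : Fin 3 → Octonion) : Prop :=
  A.mulVec v = t • v ∧ v ≠ 0

/-- `w` is orthogonal to `v` in the generalized sense: `(v v†) w = 0`. -/
def GenOrthogonal (v w : Fin 3 → Octonion) : Prop :=
  (Matrix.vecMulVec v (star v)).mulVec w = 0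

end

end Octonion

namespace Octonion

/-! Non-associativity is confined to one operator. Gram-Schmidt on `1, a, b, c` gives orthogonal
imaginary `e, f, g`, nonzero because `Phi` and `assoc` do not both vanish
(`exists_isOrthogonalTriple`). Their left multiplications anticommute and generate a Clifford
algebra, in which `x ↦ e (f (g x))` is central and symmetric.

Eliminating two components from `A v = s v` shows that every component of `v` is an eigenvector of
this operator. Its eigenvalue `ε` depends on `s` only through `charFun A s = r`, so one eigenspace
`tripleSpace e f g ε` serves the whole family.

On that space `ε ≠ 0` makes `e f` act as a multiple of `g`, and products `x ȳ` stay in the span of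
`1, e, f, g` (`exists_mul_star_eq`). Hence the entries of `A` associate with such products
(`mul_mul_star_mul₁`), and the classical orthogonality argument for Hermitian matrices goes through
(`genOrthogonal_of_tripleSpace`). -/

theorem ext_coords {x y : Octonion} (h₀ : x.fst.re = y.fst.re) (h₁ : x.fst.imI = y.fst.imI)
    (h₂ : x.fst.imJ = y.fst.imJ) (h₃ : x.fst.imK = y.fst.imK) (h₄ : x.snd.re = y.snd.re)
    (h₅ : x.snd.imI = y.snd.imI) (h₆ : x.snd.imJ = y.snd.imJ) (h₇ : x.snd.imK = y.snd.imK) :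
    x = y :=
  Octonion.ext (QuaternionAlgebra.ext h₀ h₁ h₂ h₃) (QuaternionAlgebra.ext h₄ h₅ h₆ h₇)

/-! ### Inner product, composition identities and alternativity. -/

instance : IsScalarTower ℝ Octonion Octonion where
  smul_assoc t x y := by ext1 <;> simp [smul_sub]

instance : SMulCommClass ℝ Octonion Octonion where
  smul_comm t x y := by ext1 <;> simp [smul_sub]

instance : StarRing Octonion where
  star_involutive x := by ext1 <;> simp
  star_mul x y := by ext1 <;> simp [add_comm]
  star_add x y := by ext1 <;> simp [add_comm]

instance : StarModule ℝ Octonion where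
  star_smul t x := by ext1 <;> simp

/-- The Euclidean inner product `Re (x̄ y)`. -/
noncomputable def dot (x y : Octonion) : ℝ := re (star x * y)

@[simp] theorem re_add (x y : Octonion) : re (x + y) = re x + re y := by simp [re]

@[simp] theorem re_smul (t : ℝ) (x : Octonion) : re (t • x) = t * re x := by simp [re]

@[simp] theorem re_zero : re 0 = 0 := by simp [re, Quaternion.re_zero]

@[simp] theorem re_one : re 1 = 1 := by simp [re, Quaternion.re_one]

@[simp] theorem re_sub (x y : Octonion) : re (x - y) = re x - re y := by
  rw [sub_eq_add_neg, re_add, sub_eq_add_neg]; simp [re]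

@[simp] theorem re_neg (x : Octonion) : re (-x) = -re x := by simp [re]

theorem dot_eq (x y : Octonion) : dot x y =
    x.fst.re * y.fst.re + x.fst.imI * y.fst.imI + x.fst.imJ * y.fst.imJ + x.fst.imK * y.fst.imK +
    x.snd.re * y.snd.re + x.snd.imI * y.snd.imI + x.snd.imJ * y.snd.imJ +
    x.snd.imK * y.snd.imK := by
  simp [dot, re]; ring

theorem dot_comm (x y : Octonion) : dot x y = dot y x := by
  simp only [dot_eq]; ring

theorem dot_add_right (x y z : Octonion) : dot x (y + z) = dot x y + dot x z := by
  simp [dot, mul_add]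

theorem dot_add_left (x y z : Octonion) : dot (x + y) z = dot x z + dot y z := by
  simp [dot, add_mul]

theorem dot_smul_right (t : ℝ) (x y : Octonion) : dot x (t • y) = t * dot x y := by
  rw [dot, mul_smul_comm, re_smul, dot]

theorem dot_smul_left (t : ℝ) (x y : Octonion) : dot (t • x) y = t * dot x y := by
  rw [dot, star_smul, star_trivial, smul_mul_assoc, re_smul, dot]

theorem dot_neg_left (x y : Octonion) : dot (-x) y = -dot x y := by simp [dot]

theorem dot_neg_right (x y : Octonion) : dot x (-y) = -dot x y := by simp [dot]

theorem dot_one_left (x : Octonion) : dot 1 x = re x := by simp [dot]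

theorem eq_zero_of_dot_self {x : Octonion} (h : dot x x = 0) : x = 0 := by
  rw [dot_eq] at h
  apply ext_coords <;> simp only [zero_fst, zero_snd, Quaternion.re_zero, Quaternion.imI_zero,
    Quaternion.imJ_zero, Quaternion.imK_zero] <;> nlinarith only [h, sq_nonneg x.fst.re,
    sq_nonneg x.fst.imI, sq_nonneg x.fst.imJ, sq_nonneg x.fst.imK, sq_nonneg x.snd.re,
    sq_nonneg x.snd.imI, sq_nonneg x.snd.imJ, sq_nonneg x.snd.imK]

theorem dot_self_ne_zero {x : Octonion} (h : x ≠ 0) : dot x x ≠ 0 :=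
  fun h' => h (eq_zero_of_dot_self h')

theorem dot_star_star (x y : Octonion) : dot (star x) (star y) = dot x y := by
  simp [dot_eq]

theorem star_mul_mul_cancel (x z : Octonion) : star x * (x * z) = dot x x • z := by
  rw [dot_eq]
  apply ext_coords <;> simp <;> ring

theorem mul_star_mul_cancel (x z : Octonion) : x * (star x * z) = dot x x • z := by
  simpa [dot_star_star] using star_mul_mul_cancel (star x) z

theorem mul_mul_star_cancel (z x : Octonion) : z * x * star x = dot x x • z := by
  simpa using congrArg star (mul_star_mul_cancel x (star z))

theorem mul_star_mul_cancel_right (z x : Octonion) : z * star x * x = dot x x • z := by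
  simpa using congrArg star (star_mul_mul_cancel x (star z))

/-- Polarization of `star_mul_mul_cancel`; the source of all anticommutation below. -/
theorem star_mul_mul_add (x y z : Octonion) :
    star x * (y * z) + star y * (x * z) = (2 * dot x y) • z := by
  have h := star_mul_mul_cancel (x + y) z
  simp only [star_add, add_mul, mul_add, star_mul_mul_cancel, dot_add_left, dot_add_right,
    dot_comm y x] at h
  linear_combination (norm := module) h

theorem mul_star_self (x : Octonion) : x * star x = dot x x • 1 := by
  simpa using mul_star_mul_cancel x 1

theorem star_mul_self (x : Octonion) : star x * x = dot x x • 1 := by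
  simpa using star_mul_mul_cancel x 1

theorem dot_mul_right (x q u : Octonion) : dot x (q * u) = dot (star q * x) u := by
  simp only [dot_eq]
  simp
  ring

theorem dot_mul_star (q x y : Octonion) : dot q (x * star y) = dot (q * y) x := by
  simp only [dot_eq]
  simp
  ring

theorem star_eq (x : Octonion) : star x = (2 * re x) • (1 : Octonion) - x := by
  rw [sub_eq_add_neg]
  apply ext_coords <;> simp [re, Quaternion.re_one, Quaternion.imI_one,
    Quaternion.imJ_one, Quaternion.imK_one]
  ring

theorem re_mul_comm (x y : Octonion) : re (x * y) = re (y * x) := by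
  simp [re]; ring

/-- Substitute `x̄ = 2 Re x - x` in `x̄ (x y) = |x|² y = (x̄ x) y`. -/
theorem mul_self_mul (x y : Octonion) : x * x * y = x * (x * y) := by
  have h₁ := star_mul_mul_cancel x y
  have h₂ := congrArg (· * y) (star_mul_self x)
  simp only [star_eq, sub_mul, smul_mul_assoc, one_mul] at h₁ h₂
  rw [← sub_right_inj, h₁, h₂]

theorem mul_mul_self (x y : Octonion) : x * (y * y) = x * y * y := by
  have h₁ := mul_mul_star_cancel x y
  have h₂ := congrArg (x * ·) (mul_star_self y)
  simp only [star_eq, mul_sub, mul_smul_comm, mul_one] at h₁ h₂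
  rw [← sub_right_inj, h₁, h₂]

theorem mul_mul_flexible (x y : Octonion) : x * y * x = x * (y * x) := by
  have h := mul_self_mul (x + y) x
  simp only [add_mul, mul_add, mul_self_mul] at h
  rw [mul_mul_self y x] at h
  have h' : x * y * x - x * (y * x) = 0 := by
    rw [← sub_eq_zero] at h
    rw [← h]; abel
  exact sub_eq_zero.1 h'

theorem eq_re_smul_one_of_star_eq {x : Octonion} (h : star x = x) : x = re x • 1 := by
  have h₁ := congrArg (fun z => z.fst.imI) h
  have h₂ := congrArg (fun z => z.fst.imJ) h
  have h₃ := congrArg (fun z => z.fst.imK) h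
  have h₄ := congrArg (fun z => z.snd.re) h
  have h₅ := congrArg (fun z => z.snd.imI) h
  have h₆ := congrArg (fun z => z.snd.imJ) h
  have h₇ := congrArg (fun z => z.snd.imK) h
  simp at h₁ h₂ h₃ h₄ h₅ h₆ h₇
  apply ext_coords <;> simp [re, Quaternion.re_one, Quaternion.imI_one,
    Quaternion.imJ_one, Quaternion.imK_one, Quaternion.re_zero, Quaternion.imI_zero,
    Quaternion.imJ_zero, Quaternion.imK_zero] <;> linarith

theorem star_sub_re (x : Octonion) : star (x - re x • 1) = -(x - re x • 1) := by
  rw [star_sub, star_smul, star_one, star_trivial (re x), star_eq, mul_smul, two_smul]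
  abel

theorem dot_one_of_star_eq_neg {x : Octonion} (h : star x = -x) : dot x 1 = 0 := by
  have h' := congrArg re h
  rw [star_eq] at h'
  simp at h'
  rw [dot_comm, dot_one_left]
  linarith

/-! ### The eigenspaces of `x ↦ e (f (g x))`. -/

/-- Three nonzero, mutually orthogonal imaginary octonions. -/
structure IsOrthogonalTriple (e f g : Octonion) : Prop where
  star₁ : star e = -e
  star₂ : star f = -f
  star₃ : star g = -g
  dot₁₂ : dot e f = 0
  dot₂₃ : dot f g = 0
  dot₃₁ : dot g e = 0
  ne₁ : e ≠ 0
  ne₂ : f ≠ 0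
  ne₃ : g ≠ 0

theorem mul_mul_swap {e f : Octonion} (he : star e = -e) (hf : star f = -f) (h : dot e f = 0)
    (x : Octonion) : e * (f * x) = -(f * (e * x)) := by
  have := star_mul_mul_add e f x
  rw [he, hf, h] at this
  simp only [neg_mul, mul_zero, zero_smul] at this
  rw [neg_add_eq_zero] at this
  rw [this]

theorem mul_mul_self_of_star_eq_neg {e : Octonion} (he : star e = -e) (x : Octonion) :
    e * (e * x) = -(dot e e • x) := by
  have := star_mul_mul_cancel e x
  rw [he, neg_mul] at this
  rw [← this, neg_neg]

/-- The eigenspace of `x ↦ e (f (g x))` for the eigenvalue `ε`. -/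
noncomputable def tripleSpace (e f g : Octonion) (ε : ℝ) : Submodule ℝ Octonion where
  carrier := {x | e * (f * (g * x)) = ε • x}
  add_mem' {x y} hx hy := by
    simp only [Set.mem_ofPred_eq] at hx hy ⊢
    rw [mul_add, mul_add, mul_add, hx, hy, smul_add]
  zero_mem' := by simp
  smul_mem' t x hx := by
    simp only [Set.mem_ofPred_eq] at hx ⊢
    rw [mul_smul_comm, mul_smul_comm, mul_smul_comm, hx, smul_comm]

theorem mem_tripleSpace {e f g x : Octonion} {ε : ℝ} :
    x ∈ tripleSpace e f g ε ↔ e * (f * (g * x)) = ε • x := Iff.rfl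

namespace IsOrthogonalTriple

variable {e f g : Octonion} {ε : ℝ}

theorem rotate (T : IsOrthogonalTriple e f g) : IsOrthogonalTriple f g e :=
  ⟨T.star₂, T.star₃, T.star₁, T.dot₂₃, T.dot₃₁, T.dot₁₂, T.ne₂, T.ne₃, T.ne₁⟩

theorem swap₁₂ (T : IsOrthogonalTriple e f g) (x : Octonion) : e * (f * x) = -(f * (e * x)) :=
  mul_mul_swap T.star₁ T.star₂ T.dot₁₂ x

/-- Moving `e` past `g` and `f` costs two signs. The cyclic symmetry lets each fact about `e` be
transported to `f` and `g`. -/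
theorem mul_mul_mul_rotate (T : IsOrthogonalTriple e f g) (x : Octonion) :
    f * (g * (e * x)) = e * (f * (g * x)) := by
  rw [T.rotate.rotate.swap₁₂, T.swap₁₂, mul_neg]

theorem mem_rotate (T : IsOrthogonalTriple e f g) {x : Octonion} (hx : x ∈ tripleSpace e f g ε) :
    x ∈ tripleSpace f g e ε := by
  rw [mem_tripleSpace] at hx ⊢
  rw [T.mul_mul_mul_rotate, hx]

theorem mul_mem₁ (T : IsOrthogonalTriple e f g) {x : Octonion} (hx : x ∈ tripleSpace e f g ε) :
    e * x ∈ tripleSpace e f g ε := by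
  rw [mem_tripleSpace] at hx ⊢
  rw [T.mul_mul_mul_rotate, hx, mul_smul_comm]

theorem mul_mem₂ (T : IsOrthogonalTriple e f g) {x : Octonion} (hx : x ∈ tripleSpace e f g ε) :
    f * x ∈ tripleSpace e f g ε :=
  T.rotate.rotate.mem_rotate (T.rotate.mem_rotate (T.rotate.mul_mem₁ (T.mem_rotate hx)))

theorem mul_mem₃ (T : IsOrthogonalTriple e f g) {x : Octonion} (hx : x ∈ tripleSpace e f g ε) :
    g * x ∈ tripleSpace e f g ε :=
  T.rotate.rotate.mem_rotate
    (T.rotate.rotate.mul_mem₁ (T.rotate.mem_rotate (T.mem_rotate hx)))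

/-- Apply the eigenvalue equation to `g u` and use `g (g u) = -|g|² u`. -/
theorem mul_mul₁₂ (T : IsOrthogonalTriple e f g) {u : Octonion} (hu : u ∈ tripleSpace e f g ε) :
    e * (f * u) = (-(ε / dot g g)) • (g * u) := by
  have h := mem_tripleSpace.1 (T.mul_mem₃ hu)
  rw [mul_mul_self_of_star_eq_neg T.star₃, mul_neg, mul_neg, mul_smul_comm, mul_smul_comm] at h
  have hg := dot_self_ne_zero T.ne₃
  apply smul_right_injective _ hg
  simp only [smul_smul]
  rw [mul_neg, mul_div_cancel₀ _ hg, neg_smul, ← h, neg_neg]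

theorem mul_mul₁₃ (T : IsOrthogonalTriple e f g) {u : Octonion} (hu : u ∈ tripleSpace e f g ε) :
    e * (g * u) = (ε / dot f f) • (f * u) := by
  rw [← neg_neg (e * (g * u)), ← T.rotate.rotate.swap₁₂,
    T.rotate.rotate.mul_mul₁₂ (T.rotate.mem_rotate (T.mem_rotate hu)), neg_smul, neg_neg]

/-- The adjoint reverses the three factors and negates each one; the reversal is an odd permutation,
so the signs cancel. -/
theorem dot_mul_mul_mul (T : IsOrthogonalTriple e f g) (x y : Octonion) :
    dot (e * (f * (g * x))) y = dot x (e * (f * (g * y))) := by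
  have h : e * (f * (g * y)) = -(g * (f * (e * y))) := by
    rw [T.rotate.swap₁₂, mul_neg, ← T.rotate.rotate.swap₁₂, T.swap₁₂, mul_neg]
  rw [h, dot_neg_right, dot_mul_right, dot_mul_right, dot_mul_right, T.star₁, T.star₂, T.star₃]
  simp only [neg_mul, mul_neg, dot_neg_left, neg_neg]

/-- Products `x ȳ` of elements of the eigenspace are combinations of `1, e, f, g`. -/
theorem exists_mul_star_eq (T : IsOrthogonalTriple e f g) (hε : ε ≠ 0) {x y : Octonion}
    (hx : x ∈ tripleSpace e f g ε) (hy : y ∈ tripleSpace e f g ε) :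
    ∃ t₀ t₁ t₂ t₃ : ℝ, x * star y = t₀ • (1 : Octonion) + t₁ • e + t₂ • f + t₃ • g := by
  set q := x * star y with hq
  -- The component of `q` orthogonal to `1, e, f, g`; the aim is `p = 0`.
  set p := (q - re q • 1) + (-(dot e q / dot e e)) • e + (-(dot f q / dot f f)) • f +
    (-(dot g q / dot g g)) • g with hp
  have he := dot_self_ne_zero T.ne₁
  have hf := dot_self_ne_zero T.ne₂
  have hg := dot_self_ne_zero T.ne₃
  have re₁ : dot e 1 = 0 := dot_one_of_star_eq_neg T.star₁
  have re₂ : dot f 1 = 0 := dot_one_of_star_eq_neg T.star₂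
  have re₃ : dot g 1 = 0 := dot_one_of_star_eq_neg T.star₃
  have hps : star p = -p := by
    rw [hp]
    simp only [star_add, star_smul, star_trivial, star_sub_re, T.star₁, T.star₂, T.star₃]
    module
  have d21 : dot f e = 0 := by rw [dot_comm, T.dot₁₂]
  have d32 : dot g f = 0 := by rw [dot_comm, T.dot₂₃]
  have d13 : dot e g = 0 := by rw [dot_comm, T.dot₃₁]
  have ep : dot e p = 0 := by
    simp only [hp, sub_eq_add_neg, ← neg_smul, dot_add_right, dot_smul_right, re₁, T.dot₁₂, d13]
    field_simp; ring
  have fp : dot f p = 0 := by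
    simp only [hp, sub_eq_add_neg, ← neg_smul, dot_add_right, dot_smul_right, re₂, T.dot₂₃, d21]
    field_simp; ring
  have gp : dot g p = 0 := by
    simp only [hp, sub_eq_add_neg, ← neg_smul, dot_add_right, dot_smul_right, re₃, T.dot₃₁, d32]
    field_simp; ring
  have p1 : dot p 1 = 0 := dot_one_of_star_eq_neg hps
  -- `p` anticommutes with `e`, `f` and `g`, so `p y` has eigenvalue `-ε` and is orthogonal to `x`;
  -- thus `⟨p, x ȳ⟩ = ⟨p y, x⟩ = 0`.
  have hpy : e * (f * (g * (p * y))) = -(ε • (p * y)) := by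
    rw [mul_mul_swap T.star₃ hps gp, mul_neg, mul_neg, mul_mul_swap T.star₂ hps fp, mul_neg,
      neg_neg, mul_mul_swap T.star₁ hps ep, mem_tripleSpace.1 hy, mul_smul_comm]
  have hpq : dot p q = 0 := by
    rw [hq, dot_mul_star]
    have h := T.dot_mul_mul_mul (p * y) x
    rw [hpy, mem_tripleSpace.1 hx, dot_neg_left, dot_smul_left, dot_smul_right] at h
    have : ε * dot (p * y) x = 0 := by linarith
    exact (mul_eq_zero.1 this).resolve_left hε
  have hpp : dot p p = 0 := by
    have h := congrArg (dot p) hp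
    simpa only [sub_eq_add_neg, ← neg_smul, dot_add_right, dot_smul_right, hpq, p1,
      (dot_comm p e).trans ep, (dot_comm p f).trans fp, (dot_comm p g).trans gp, mul_zero,
      add_zero] using h
  have hp0 := eq_zero_of_dot_self hpp
  refine ⟨re q, dot e q / dot e e, dot f q / dot f f, dot g q / dot g g, ?_⟩
  rw [← sub_eq_zero, ← hp0, hp]
  module

/-- Left multiplications act associatively on the eigenspace. -/
theorem mul_mul_star_mul₁ (T : IsOrthogonalTriple e f g) (hε : ε ≠ 0) {x y u : Octonion}
    (hx : x ∈ tripleSpace e f g ε) (hy : y ∈ tripleSpace e f g ε)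
    (hu : u ∈ tripleSpace e f g ε) : e * (x * star y * u) = e * x * star y * u := by
  rcases eq_or_ne y 0 with rfl | hy0
  · simp
  obtain ⟨t₀, t₁, t₂, t₃, h⟩ := T.exists_mul_star_eq hε hx hy
  -- A single octonion, independent of `u`, represents the composite. Taking `u = y` and multiplying
  -- by `ȳ` on the right identifies it as `(e x) ȳ`.
  have key : ∀ u ∈ tripleSpace e f g ε, e * (x * star y * u) =
      (t₀ • e - (t₁ * dot e e) • (1 : Octonion) - (t₂ * (ε / dot g g)) • g +
        (t₃ * (ε / dot f f)) • f) * u := by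
    intro u hu
    rw [h]
    simp only [add_mul, sub_mul, smul_mul_assoc, one_mul, mul_add, mul_smul_comm,
      mul_mul_self_of_star_eq_neg T.star₁, T.mul_mul₁₂ hu, T.mul_mul₁₃ hu]
    module
  have h' := congrArg (· * star y) (key y hy)
  simp only [mul_star_mul_cancel_right, mul_mul_star_cancel, mul_smul_comm, smul_mul_assoc] at h'
  rw [key u hu, ← smul_right_injective _ (dot_self_ne_zero hy0) h']

theorem mul_mul_star_mul₂ (T : IsOrthogonalTriple e f g) (hε : ε ≠ 0) {x y u : Octonion}
    (hx : x ∈ tripleSpace e f g ε) (hy : y ∈ tripleSpace e f g ε)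
    (hu : u ∈ tripleSpace e f g ε) : f * (x * star y * u) = f * x * star y * u :=
  T.rotate.mul_mul_star_mul₁ hε (T.mem_rotate hx) (T.mem_rotate hy) (T.mem_rotate hu)

theorem mul_mul_star_mul₃ (T : IsOrthogonalTriple e f g) (hε : ε ≠ 0) {x y u : Octonion}
    (hx : x ∈ tripleSpace e f g ε) (hy : y ∈ tripleSpace e f g ε)
    (hu : u ∈ tripleSpace e f g ε) : g * (x * star y * u) = g * x * star y * u :=
  T.rotate.mul_mul_star_mul₂ hε (T.mem_rotate hx) (T.mem_rotate hy) (T.mem_rotate hu)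

theorem mul_star_mul_mem (T : IsOrthogonalTriple e f g) (hε : ε ≠ 0) {x y u : Octonion}
    (hx : x ∈ tripleSpace e f g ε) (hy : y ∈ tripleSpace e f g ε)
    (hu : u ∈ tripleSpace e f g ε) : x * star y * u ∈ tripleSpace e f g ε := by
  obtain ⟨t₀, t₁, t₂, t₃, h⟩ := T.exists_mul_star_eq hε hx hy
  rw [h]
  simp only [add_mul, smul_mul_assoc, one_mul]
  exact add_mem (add_mem (add_mem (Submodule.smul_mem _ _ hu)
    (Submodule.smul_mem _ _ (T.mul_mem₁ hu))) (Submodule.smul_mem _ _ (T.mul_mem₂ hu)))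
    (Submodule.smul_mem _ _ (T.mul_mem₃ hu))

end IsOrthogonalTriple

/-! ### Degenerate triples and Gram-Schmidt. -/

theorem assoc_phi_of_left_real (t : ℝ) (b c : Octonion) :
    assoc (t • 1) b c = 0 ∧ Phi (t • 1) b c = 0 := by
  constructor
  · simp [assoc, smul_mul_assoc]
  · simp only [Phi, smul_mul_assoc, mul_smul_comm, one_mul, mul_one, re_sub, re_smul,
      re_mul_comm c]
    ring

theorem assoc_phi_of_mid_mem (t₀ t₁ : ℝ) (a c : Octonion) :
    assoc a (t₀ • 1 + t₁ • a) c = 0 ∧ Phi a (t₀ • 1 + t₁ • a) c = 0 := by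
  constructor
  · simp [assoc, smul_mul_assoc, mul_smul_comm, mul_add, add_mul, mul_self_mul]
  · simp only [Phi, star_add, star_smul, star_one, star_trivial, mul_add, add_mul,
      smul_mul_assoc, mul_smul_comm, one_mul, mul_one, re_sub, re_add, re_smul,
      mul_star_mul_cancel, star_mul_self, re_mul_comm c]
    ring

theorem assoc_phi_of_right_mem (t₀ t₁ t₂ : ℝ) (a b : Octonion) :
    assoc a b (t₀ • 1 + t₁ • a + t₂ • b) = 0 ∧ Phi a b (t₀ • 1 + t₁ • a + t₂ • b) = 0 := by
  constructor
  · simp [assoc, mul_smul_comm, mul_add, mul_mul_self, mul_mul_flexible]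
  · simp only [Phi, mul_add, add_mul, smul_mul_assoc, mul_smul_comm, one_mul, mul_one, re_sub,
      re_add, re_smul, mul_star_mul_cancel, star_mul_self, re_mul_comm a (star b)]
    ring

theorem dot_sub_right (x y z : Octonion) : dot x (y - z) = dot x y - dot x z := by
  rw [sub_eq_add_neg, dot_add_right, dot_neg_right, sub_eq_add_neg]

theorem exists_isOrthogonalTriple {a b c : Octonion} (h : ¬(assoc a b c = 0 ∧ Phi a b c = 0)) :
    ∃ e f g, IsOrthogonalTriple e f g ∧ ∃ a₀ b₀ b₁ c₀ c₁ c₂ : ℝ, a = a₀ • (1 : Octonion) + e ∧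
      b = b₀ • (1 : Octonion) + b₁ • e + f ∧
      c = c₀ • (1 : Octonion) + c₁ • e + c₂ • f + g := by
  obtain ⟨e, he⟩ : ∃ e, e = a - re a • (1 : Octonion) := ⟨_, rfl⟩
  obtain ⟨f, hf⟩ : ∃ f, f = b - re b • (1 : Octonion) - (dot e b / dot e e) • e := ⟨_, rfl⟩
  obtain ⟨g, hg⟩ : ∃ g, g = c - re c • (1 : Octonion) - (dot e c / dot e e) • e -
    (dot f c / dot f f) • f := ⟨_, rfl⟩
  have se : star e = -e := by rw [he, star_sub_re]
  have sf : star f = -f := by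
    rw [hf, star_sub, star_sub_re, star_smul, star_trivial (dot e b / dot e e), se]; module
  have sg : star g = -g := by
    rw [hg, star_sub, star_sub, star_sub_re, star_smul, star_smul,
      star_trivial (dot e c / dot e e), star_trivial (dot f c / dot f f), se, sf]
    module
  have e0 : e ≠ 0 := by
    intro h0
    apply h
    rw [h0, eq_comm, sub_eq_zero] at he
    rw [he]
    exact assoc_phi_of_left_real _ _ _
  have f0 : f ≠ 0 := by
    intro h0
    apply h
    generalize dot e b / dot e e = t at hf
    have : b = (re b - t * re a) • (1 : Octonion) + t • a := by
      rw [← sub_eq_zero, ← h0, hf, he]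
      module
    rw [this]
    exact assoc_phi_of_mid_mem _ _ _ _
  have g0 : g ≠ 0 := by
    intro h0
    apply h
    generalize dot e b / dot e e = t at hf
    generalize dot e c / dot e e = t₁ at hg
    generalize dot f c / dot f f = t₂ at hg
    have : c = (re c - t₁ * re a - t₂ * (re b - t * re a)) • (1 : Octonion) +
        (t₁ - t₂ * t) • a + t₂ • b := by
      rw [← sub_eq_zero, ← h0, hg, hf, he]
      module
    rw [this]
    exact assoc_phi_of_right_mem _ _ _ _ _
  have ne := dot_self_ne_zero e0
  have nf := dot_self_ne_zero f0
  have ef : dot e f = 0 := by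
    rw [hf, dot_sub_right, dot_sub_right, dot_smul_right, dot_smul_right,
      dot_one_of_star_eq_neg se]
    field_simp; ring
  have eg : dot e g = 0 := by
    rw [hg, dot_sub_right, dot_sub_right, dot_sub_right, dot_smul_right, dot_smul_right,
      dot_smul_right, dot_one_of_star_eq_neg se, ef]
    field_simp; ring
  have fg : dot f g = 0 := by
    rw [hg, dot_sub_right, dot_sub_right, dot_sub_right, dot_smul_right, dot_smul_right,
      dot_smul_right, dot_one_of_star_eq_neg sf, dot_comm f e, ef]
    field_simp; ring
  refine ⟨e, f, g, ⟨se, sf, sg, ef, fg, (dot_comm g e).trans eg, e0, f0, g0⟩, re a, re b,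
    dot e b / dot e e, re c, dot e c / dot e e, dot f c / dot f f, ?_, ?_, ?_⟩
  · rw [he]; module
  · rw [hf]; module
  · rw [hg]; module

/-! ### From the eigenvalue equations to the triple product. -/

/-- Eliminating two components from the eigenvalue equations. -/
theorem eliminate {a b c x y z : Octonion} {P M N : ℝ} (h₁ : a * y + star b * z = P • x)
    (h₂ : star a * x + c * z = M • y) (h₃ : b * x + star c * y = N • z) :
    (P * M * N - N * dot a a - M * dot b b - P * dot c c) • x =
      a * (c * (b * x)) + star b * (star c * (star a * x)) := by
  have k₁ := congrArg (fun q => N • (a * q)) h₂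
  have k₂ := congrArg (fun q => M • (star b * q)) h₃
  have k₃ := congrArg (fun q => a * (c * q)) h₃
  have k₄ := congrArg (fun q => star b * (star c * q)) h₂
  have k₅ := congrArg (fun q => dot c c • q) h₁
  have k₆ := congrArg (fun q => (M * N) • q) h₁
  simp only [mul_add, mul_smul_comm, mul_star_mul_cancel, star_mul_mul_cancel] at k₁ k₂ k₃ k₄ k₅ k₆
  linear_combination (norm := module) -k₁ - k₂ - k₃ - k₄ + k₅ - k₆

namespace IsOrthogonalTriple

variable {e f g : Octonion}

/-- The left side is a product of three left multiplications plus its adjoint. Only symmetric terms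
survive: scalars and the triple product. The same scalar occurs in `cubic₂` and `cubic₃`, so all
three components of an eigenvector share one `ε`. -/
theorem cubic₁ (T : IsOrthogonalTriple e f g) (a₀ b₀ b₁ c₀ c₁ c₂ : ℝ) (x : Octonion) :
    (a₀ • (1 : Octonion) + e) * ((c₀ • (1 : Octonion) + c₁ • e + c₂ • f + g) *
      ((b₀ • (1 : Octonion) + b₁ • e + f) * x)) +
    (b₀ • (1 : Octonion) + (-b₁) • e - f) * ((c₀ • (1 : Octonion) + (-c₁) • e + (-c₂) • f - g) *
      ((a₀ • (1 : Octonion) - e) * x)) =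
    (2 * (a₀ * b₀ * c₀ - a₀ * (b₁ * c₁ * dot e e + c₂ * dot f f) - b₀ * c₁ * dot e e
      - c₀ * b₁ * dot e e)) • x - (2 : ℝ) • (e * (f * (g * x))) := by
  have h₁₂ := fun x => neg_eq_iff_eq_neg.2 (T.swap₁₂ x)
  have h₂₃ := fun x => neg_eq_iff_eq_neg.2 (T.rotate.swap₁₂ x)
  simp only [add_mul, sub_mul, mul_add, mul_sub, mul_neg, smul_mul_assoc, mul_smul_comm,
    one_mul,
    mul_mul_self_of_star_eq_neg T.star₁, mul_mul_self_of_star_eq_neg T.star₂, ← h₁₂, ← h₂₃,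
    T.rotate.rotate.swap₁₂, smul_neg]
  module

theorem cubic₂ (T : IsOrthogonalTriple e f g) (a₀ b₀ b₁ c₀ c₁ c₂ : ℝ) (x : Octonion) :
    (c₀ • (1 : Octonion) + c₁ • e + c₂ • f + g) * ((b₀ • (1 : Octonion) + b₁ • e + f) *
      ((a₀ • (1 : Octonion) + e) * x)) +
    (a₀ • (1 : Octonion) - e) * ((b₀ • (1 : Octonion) + (-b₁) • e - f) *
      ((c₀ • (1 : Octonion) + (-c₁) • e + (-c₂) • f - g) * x)) =
    (2 * (a₀ * b₀ * c₀ - a₀ * (b₁ * c₁ * dot e e + c₂ * dot f f) - b₀ * c₁ * dot e e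
      - c₀ * b₁ * dot e e)) • x - (2 : ℝ) • (e * (f * (g * x))) := by
  have h₁₂ := fun x => neg_eq_iff_eq_neg.2 (T.swap₁₂ x)
  have h₂₃ := fun x => neg_eq_iff_eq_neg.2 (T.rotate.swap₁₂ x)
  simp only [add_mul, sub_mul, mul_add, mul_sub, mul_neg, smul_mul_assoc, mul_smul_comm,
    one_mul,
    mul_mul_self_of_star_eq_neg T.star₁, mul_mul_self_of_star_eq_neg T.star₂, ← h₁₂, ← h₂₃,
    T.rotate.rotate.swap₁₂, smul_neg]
  module

theorem cubic₃ (T : IsOrthogonalTriple e f g) (a₀ b₀ b₁ c₀ c₁ c₂ : ℝ) (x : Octonion) :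
    (b₀ • (1 : Octonion) + b₁ • e + f) * ((a₀ • (1 : Octonion) + e) *
      ((c₀ • (1 : Octonion) + c₁ • e + c₂ • f + g) * x)) +
    (c₀ • (1 : Octonion) + (-c₁) • e + (-c₂) • f - g) * ((a₀ • (1 : Octonion) - e) *
      ((b₀ • (1 : Octonion) + (-b₁) • e - f) * x)) =
    (2 * (a₀ * b₀ * c₀ - a₀ * (b₁ * c₁ * dot e e + c₂ * dot f f) - b₀ * c₁ * dot e e
      - c₀ * b₁ * dot e e)) • x - (2 : ℝ) • (e * (f * (g * x))) := by
  have h₁₂ := fun x => neg_eq_iff_eq_neg.2 (T.swap₁₂ x)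
  have h₂₃ := fun x => neg_eq_iff_eq_neg.2 (T.rotate.swap₁₂ x)
  simp only [add_mul, sub_mul, mul_add, mul_sub, mul_neg, smul_mul_assoc, mul_smul_comm,
    one_mul,
    mul_mul_self_of_star_eq_neg T.star₁, mul_mul_self_of_star_eq_neg T.star₂, ← h₁₂, ← h₂₃,
    T.rotate.rotate.swap₁₂, smul_neg]
  module

theorem eq_zero_of_mul_mul_mul (T : IsOrthogonalTriple e f g) {x : Octonion}
    (h : e * (f * (g * x)) = 0) : x = 0 := by
  have key : ∀ {q : Octonion}, q ≠ 0 → ∀ {z : Octonion}, q * z = 0 → z = 0 := by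
    intro q hq z hz
    have := star_mul_mul_cancel q z
    rw [hz, mul_zero, eq_comm, smul_eq_zero] at this
    exact this.resolve_left (dot_self_ne_zero hq)
  exact key T.ne₃ (key T.ne₂ (key T.ne₁ h))

end IsOrthogonalTriple

/-! ### Orthogonality and the final assembly. -/

theorem genOrthogonal_of_tripleSpace {e f g : Octonion} {ε : ℝ} (T : IsOrthogonalTriple e f g)
    (hε : ε ≠ 0) {A : Mat3} (hA : A.IsHermitian)
    (hAT : ∀ j k, ∃ t₀ t₁ t₂ t₃ : ℝ, A j k = t₀ • (1 : Octonion) + t₁ • e + t₂ • f + t₃ • g)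
    {s t : ℝ} (hst : s ≠ t) {v w : Fin 3 → Octonion} (hv : A.mulVec v = s • v)
    (hw : A.mulVec w = t • w) (hvT : ∀ i, v i ∈ tripleSpace e f g ε)
    (hwT : ∀ i, w i ∈ tripleSpace e f g ε) : GenOrthogonal v w := by
  funext i
  set u := (Matrix.vecMulVec v (star v)).mulVec w i with hu
  have hu' : u = ∑ j, v i * star (v j) * w j := rfl
  have huT : u ∈ tripleSpace e f g ε := by
    rw [hu']
    exact sum_mem fun j _ => T.mul_star_mul_mem hε (hvT i) (hvT j) (hwT j)
  -- By associativity on the eigenspace, the vector `(v v̄ᵢ) u` is again an eigenvector for `s`.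
  have hAg : ∀ j, ∑ k, A j k * (v k * star (v i) * u) = s • (v j * star (v i) * u) := by
    intro j
    have h : ∀ k, A j k * (v k * star (v i) * u) = A j k * v k * star (v i) * u := by
      intro k
      obtain ⟨t₀, t₁, t₂, t₃, h⟩ := hAT j k
      rw [h]
      simp only [add_mul, smul_mul_assoc, one_mul,
        T.mul_mul_star_mul₁ hε (hvT k) (hvT i) huT, T.mul_mul_star_mul₂ hε (hvT k) (hvT i) huT,
        T.mul_mul_star_mul₃ hε (hvT k) (hvT i) huT]
    have hvj : ∑ k, A j k * v k = s • v j := congrFun hv j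
    simp only [h]
    rw [← Finset.sum_mul, ← Finset.sum_mul, hvj, smul_mul_assoc, smul_mul_assoc]
  have dot_sum_right : ∀ (x : Octonion) (F : Fin 3 → Octonion),
      dot x (∑ k, F k) = ∑ k, dot x (F k) := fun x F => by
    simp only [Fin.sum_univ_three, dot_add_right]
  have dot_sum_left : ∀ (x : Octonion) (F : Fin 3 → Octonion),
      dot (∑ k, F k) x = ∑ k, dot (F k) x := fun x F => by
    simp only [Fin.sum_univ_three, dot_add_left]
  have h₁ : ∑ j, dot (w j) (∑ k, A j k * (v k * star (v i) * u)) =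
      ∑ k, dot (∑ j, A k j * w j) (v k * star (v i) * u) := by
    simp only [dot_sum_right, dot_sum_left]
    rw [Finset.sum_comm]
    refine Finset.sum_congr rfl fun k _ => Finset.sum_congr rfl fun j _ => ?_
    rw [dot_mul_right, hA.apply]
  have hwk : ∀ k, ∑ j, A k j * w j = t • w k := fun k => congrFun hw k
  simp only [hAg, hwk, dot_smul_left, dot_smul_right, ← Finset.mul_sum] at h₁
  have h₂ : ∑ k, dot (w k) (v k * star (v i) * u) = 0 := by
    have : (s - t) * ∑ k, dot (w k) (v k * star (v i) * u) = 0 := by linarith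
    exact (mul_eq_zero.1 this).resolve_left (sub_ne_zero.2 hst)
  -- Moving `vₖ v̄ᵢ` to the other side turns the sum into `⟨u, u⟩`.
  simp only [dot_mul_right, star_mul, star_star] at h₂
  rw [← dot_sum_left, ← hu'] at h₂
  exact eq_zero_of_dot_self h₂

/-- The first bracket is the scalar produced by `eliminate`; the rest does not depend on `t`, so
`det A` need not be expanded. -/
theorem charFun_eq {A : Mat3} {p m n : ℝ} {a b c : Octonion} (t : ℝ)
    (hA : A = !![p • 1, a, star b; star a, m • 1, c; b, star c, n • 1]) :
    charFun A t = ((t - p) * (t - m) * (t - n) - (t - n) * dot a a - (t - m) * dot b b -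
      (t - p) * dot c c) + (p * m * n - n * dot a a - m * dot b b - p * dot c c) - det A := by
  have htr : tr A = p + m + n := by
    simp [tr, Matrix.trace_fin_three, hA]
  have hsq : tr (jordan A A) =
      p ^ 2 + m ^ 2 + n ^ 2 + 2 * (dot a a + dot b b + dot c c) := by
    simp only [tr, jordan, Matrix.trace_fin_three, hA]
    simp [star_mul_self, mul_star_self]
    ring
  rw [charFun, sigma, htr, hsq]
  ring

end Octonion

open Octonion in
theorem theorem2 (A : Matrix (Fin 3) (Fin 3) Octonion) (hA : A.IsHermitian)
    (hroots : (Octonion.familyRoots A).Nontrivial)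
    (r : ℝ) (hr : r ∈ Octonion.familyRoots A)
    (s t : ℝ) (hs : s ∈ Octonion.family A r) (ht : t ∈ Octonion.family A r) (hst : s ≠ t)
    (v w : Fin 3 → Octonion) (hv : Octonion.IsEigenvector A s v)
    (hw : Octonion.IsEigenvector A t w) :
    Octonion.GenOrthogonal v w ∧ Octonion.GenOrthogonal w v := by
  obtain ⟨p, hp⟩ : ∃ p : ℝ, A 0 0 = p • 1 := ⟨_, eq_re_smul_one_of_star_eq (hA.apply 0 0)⟩
  obtain ⟨m, hm⟩ : ∃ m : ℝ, A 1 1 = m • 1 := ⟨_, eq_re_smul_one_of_star_eq (hA.apply 1 1)⟩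
  obtain ⟨n, hn⟩ : ∃ n : ℝ, A 2 2 = n • 1 := ⟨_, eq_re_smul_one_of_star_eq (hA.apply 2 2)⟩
  have hM : A = !![p • 1, A 0 1, star (A 2 0); star (A 0 1), m • 1, A 1 2;
      A 2 0, star (A 1 2), n • 1] := by
    ext1 i j
    fin_cases i <;> fin_cases j <;> simp [hp, hm, hn, hA.apply]
  have hne : ¬(assoc (A 0 1) (A 2 0) (A 1 2) = 0 ∧ Phi (A 0 1) (A 2 0) (A 1 2) = 0) := by
    -- Otherwise the quadratic is `r² = 0`, with a single root.
    rintro ⟨h₁, h₂⟩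
    refine Set.not_subsingleton_iff.2 hroots fun x hx y hy => ?_
    simp only [familyRoots, Set.mem_ofPred_eq, h₁, h₂, normSq, zero_mul, re_zero] at hx hy
    rw [pow_eq_zero_iff two_ne_zero |>.1 (by linarith : x ^ 2 = 0),
      pow_eq_zero_iff two_ne_zero |>.1 (by linarith : y ^ 2 = 0)]
  obtain ⟨e, f, g, T, a₀, b₀, b₁, c₀, c₁, c₂, ha, hb, hc⟩ := exists_isOrthogonalTriple hne
  generalize A 0 1 = a at *
  generalize A 2 0 = b at *
  generalize A 1 2 = c at *
  have sa : star a = a₀ • (1 : Octonion) - e := by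
    rw [ha, star_add, star_smul, star_trivial a₀, star_one, T.star₁]; module
  have sb : star b = b₀ • (1 : Octonion) + (-b₁) • e - f := by
    rw [hb]
    simp only [star_add, star_smul, star_trivial, star_one, T.star₁, T.star₂]; module
  have sc : star c = c₀ • (1 : Octonion) + (-c₁) • e + (-c₂) • f - g := by
    rw [hc]
    simp only [star_add, star_smul, star_trivial, star_one, T.star₁, T.star₂, T.star₃]; module
  have hAT : ∀ j k, ∃ t₀ t₁ t₂ t₃ : ℝ,
      A j k = t₀ • (1 : Octonion) + t₁ • e + t₂ • f + t₃ • g := by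
    intro j k
    rw [hM]
    fin_cases j <;> fin_cases k
    · exact ⟨p, 0, 0, 0, by simp⟩
    · exact ⟨a₀, 1, 0, 0, by simp [ha]⟩
    · exact ⟨b₀, -b₁, -1, 0, by simp [sb, sub_eq_add_neg]⟩
    · exact ⟨a₀, -1, 0, 0, by simp [sa, sub_eq_add_neg]⟩
    · exact ⟨m, 0, 0, 0, by simp⟩
    · exact ⟨c₀, c₁, c₂, 1, by simp [hc]⟩
    · exact ⟨b₀, b₁, 1, 0, by simp [hb]⟩
    · exact ⟨c₀, -c₁, -c₂, -1, by simp [sc, sub_eq_add_neg]⟩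
    · exact ⟨n, 0, 0, 0, by simp⟩
  obtain ⟨ε, hmem⟩ : ∃ ε : ℝ, ∀ s ∈ family A r, ∀ v : Fin 3 → Octonion, A.mulVec v = s • v →
      ∀ i, v i ∈ tripleSpace e f g ε := by
    -- Obtained by equating `eliminate` with `cubic₁`, after `charFun A s = r` has removed `s`.
    refine ⟨((2 * (a₀ * b₀ * c₀ - a₀ * (b₁ * c₁ * dot e e + c₂ * dot f f) - b₀ * c₁ * dot e e
      - c₀ * b₁ * dot e e)) -
      (r - (p * m * n - n * dot a a - m * dot b b - p * dot c c) + det A)) / 2, ?_⟩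
    intro s hs v hv
    have hs' : charFun A s = r := hs
    rw [charFun_eq s hM] at hs'
    have e₁ := congrFun hv 0
    have e₂ := congrFun hv 1
    have e₃ := congrFun hv 2
    rw [hM] at e₁ e₂ e₃
    simp [Matrix.mulVec, dotProduct, Fin.sum_univ_three] at e₁ e₂ e₃
    have f₁ : a * v 1 + star b * v 2 = (s - p) • v 0 := by
      linear_combination (norm := module) e₁
    have f₂ : star a * v 0 + c * v 2 = (s - m) • v 1 := by
      linear_combination (norm := module) e₂
    have f₃ : b * v 0 + star c * v 1 = (s - n) • v 2 := by
      linear_combination (norm := module) e₃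
    -- The system is invariant under cyclic relabelling, so one elimination handles all three
    -- components.
    have k₁ := eliminate f₁ f₂ f₃
    have k₂ := eliminate ((add_comm _ _).trans f₂) ((add_comm _ _).trans f₃) f₁
    have k₃ := eliminate f₃ ((add_comm _ _).trans f₁) ((add_comm _ _).trans f₂)
    have c₁' := T.cubic₁ a₀ b₀ b₁ c₀ c₁ c₂ (v 0)
    have c₂' := T.cubic₂ a₀ b₀ b₁ c₀ c₁ c₂ (v 1)
    have c₃' := T.cubic₃ a₀ b₀ b₁ c₀ c₁ c₂ (v 2)
    rw [← sa, ← sb, ← sc, ← ha, ← hb, ← hc] at c₁' c₂' c₃'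
    simp only [Fin.forall_fin_succ, Fin.succ_zero_eq_one, Fin.succ_one_eq_two, IsEmpty.forall_iff,
      and_true, mem_tripleSpace, ← hs']
    refine ⟨?_, ?_, ?_⟩
    · linear_combination (norm := module) (1 / 2 : ℝ) • k₁ + (1 / 2 : ℝ) • c₁'
    · linear_combination (norm := module) (1 / 2 : ℝ) • k₂ + (1 / 2 : ℝ) • c₂'
    · linear_combination (norm := module) (1 / 2 : ℝ) • k₃ + (1 / 2 : ℝ) • c₃'
  have hε : ε ≠ 0 := by
    -- For `ε = 0` the triple product would kill every component of `v`, yet it is injective.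
    rintro rfl
    refine hv.2 (funext fun i => T.eq_zero_of_mul_mul_mul ?_)
    simpa [mem_tripleSpace] using hmem s hs v hv.1 i
  exact ⟨genOrthogonal_of_tripleSpace T hε hA hAT hst hv.1 hw.1 (hmem s hs v hv.1)
    (hmem t ht w hw.1), genOrthogonal_of_tripleSpace T hε hA hAT hst.symm hw.1 hv.1
    (hmem t ht w hw.1) (hmem s hs v hv.1)⟩
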